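/- Let $G$ be a Hausdorff topological group. A $G$-compactification of $G$ is a pair $(bG,b)$ where $bG$ is a compact Hausdorff space and $b:G\to bG$ is a dense topological embedding such that the action of $G$ on itself by left multiplication extends to a continuous action of $G$ on $bG$. Write $bG\le b'G$ if there is a continuous map $f:b'G\to bG$ with $f\circ b'=b$; two $G$-compactifications are identified ($=$) if there is a homeomorphism $f$ between them with $f\circ b'=b$. A $G$-compactification is a $G^*$-compactification if there is a continuous map $s:bG\to bG$ with $s\circ s=\mathrm{id}$ and $s(b(g))=b(g^{-1})$ for $g\in G$; it is an Ellis compactification if $bG$ carries a monoid multiplication $\bullet$ such that all maps $x\mapsto x\bullet y$ are continuous and $b(g)\bullet x=gx$ for all $g\in G$, $x\in bG$. The sets of $G$-, $G^*$- and Ellis compactifications are $\mathbb G(G)$, $\mathbb G^*(G)$ and $\mathbb E(G)$. For $bG\in\mathbb G(G)$ let $\mathfrak E(bG)\in\mathbb E(G)$ be the closure of $\{x\mapsto gx \mid g\in G\}$ in the product space $(bG)^{bG}$, and let $\mathfrak G(bG)\in\mathbb G^*(G)$ be the closure of the set of graphs $\{(x,gx)\mid x\in bG\}$, $g\in G$,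 in the hyperspace of closed subsets of $bG\times bG$ with the Vietoris topology. Let $b_rG$ (the Roelcke compactification) be the completion of $G$ with respect to the finest totally bounded uniformity coarser than the Roelcke uniformity $L\wedge R$ (the greatest lower bound of the left and right uniformities), and let $\beta_GG$ be the maximal $G$-compactification, i.e. the completion of $G$ with respect to the finest totally bounded equiuniformity on $G$ for the action by left multiplication. (A uniformity on $G$ inducing its topology is an equiuniformity if all left translations are uniformly continuous and for every entourage $U$ there are a neighbourhood $O$ of the unit and an entourage $V$ with $(gx,hy)\in U$ for all $g,h\in O$ and $(x,y)\in V$.) A SIN-group is a topological group whose unit has a base of conjugation-invariant neighbourhoods; equivalently, $L=R$. Then: (a) If $bG\in\mathbb G(G)$ and $b_rG\le bG$, then $b_rG=\mathfrak G(bG)\le bG\le\mathfrak E(bG)$ and $b_rG=\mathfrak G(bG)\le\mathfrak E(b_rG)\le\mathfrak E(bG)$. (b) $b_rG=\mathfrak G(\beta_GG)\le\beta_GG=\mathfrak E(\beta_GG)$. If $G$ is a SIN-group, then $b_rG=\mathfrak G(\beta_GG)=\beta_GG=\mathfrak E(\beta_GG)$. (c) If $b_rG\in\mathbb E(G)$,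 then $\mathfrak G(b_rG)=\mathfrak E(b_rG)=b_rG$. (d) If $bG\in\mathbb G^*(G)\cap\mathbb E(G)$, then $bG=\mathfrak E(bG)\le\mathfrak G(bG)\le b_rG$. -/

import Mathlib

open Filter Set Topology
open scoped Uniformity

universe u

/-- The precompact replica (totally bounded reflection) of a uniformity `𝒰`: the finest totally
bounded uniformity that is coarser than `𝒰`. (In Mathlib's order on uniformities `u ≤ v` means
that `u` is finer than `v`, so the finest member of a family is its infimum.) -/
@[reducible] def precompactReplica {X : Type u} (𝒰 : UniformSpace X) : UniformSpace X :=
  sInf {v : UniformSpace X | 𝒰 ≤ v ∧ @TotallyBounded X v univ}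

theorem le_precompactReplica {X : Type u} (𝒰 : UniformSpace X) : 𝒰 ≤ precompactReplica 𝒰 :=
  le_sInf fun _ hv => hv.1

theorem totallyBounded_univ_sInf {X : Type u} (S : Set (UniformSpace X)) (hS : S.Nonempty)
    (h : ∀ v ∈ S, @TotallyBounded X v univ) : @TotallyBounded X (sInf S) univ := by
  rw [@totallyBounded_iff_ultrafilter X (sInf S)]
  intro f hf
  have : Nonempty S := hS.to_subtype
  rw [sInf_eq_iInf', cauchy_iInf_uniformSpace]
  exact fun v => (@totallyBounded_iff_ultrafilter X v.1 univ).1 (h v.1 v.2) f hf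

theorem totallyBounded_precompactReplica {X : Type u} (𝒰 : UniformSpace X) :
    @TotallyBounded X (precompactReplica 𝒰) univ := by
  refine totallyBounded_univ_sInf _ ⟨⊤, le_top, ?_⟩ fun v hv => hv.2
  intro d hd
  rw [top_uniformity, mem_top] at hd
  by_cases hX : Nonempty X
  · exact ⟨{hX.some}, finite_singleton _, fun x _ => by simp [hd]⟩
  · exact ⟨∅, finite_empty, fun x _ => (hX ⟨x⟩).elim⟩

theorem totallyBounded_univ_comap {X Y : Type*} (v : UniformSpace Y) (f : X → Y)
    (h : @TotallyBounded Y v univ) : @TotallyBounded X (v.comap f) univ := by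
  let := v
  let : UniformSpace X := v.comap f
  have : IsUniformInducing f := ⟨rfl⟩
  simpa using totallyBounded_preimage this h

theorem uniformContinuous_precompactReplica {X : Type u} (𝒰 : UniformSpace X) (f : X → X)
    (hf : @UniformContinuous X X 𝒰 𝒰 f) :
    @UniformContinuous X X (precompactReplica 𝒰) (precompactReplica 𝒰) f := by
  rw [uniformContinuous_iff_le_comap] at hf ⊢
  refine sInf_le ⟨hf.trans (UniformSpace.comap_mono (le_precompactReplica 𝒰)), ?_⟩
  exact totallyBounded_univ_comap _ _ (totallyBounded_precompactReplica 𝒰)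

theorem exists_normal_sequence {X : Type u} [UniformSpace X] {U : Set (X × X)} (hU : U ∈ 𝓤 X) :
    ∃ W : ℕ → Set (X × X), W 0 ⊆ U ∧ (∀ n, W n ∈ 𝓤 X) ∧ (∀ n, SetRel.IsSymm (W n)) ∧
      ∀ n, SetRel.comp (W (n + 1)) (W (n + 1)) ⊆ W n := by
  have key : ∀ V : {V : Set (X × X) // V ∈ 𝓤 X}, ∃ W : {V : Set (X × X) // V ∈ 𝓤 X},
      SetRel.IsSymm W.1 ∧ SetRel.comp W.1 W.1 ⊆ V.1 := fun V => by
    obtain ⟨t, ht, hs, hc⟩ := comp_symm_mem_uniformity_sets V.2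
    exact ⟨⟨t, ht⟩, hs, hc⟩
  choose F hF1 hF2 using key
  let W : ℕ → {V : Set (X × X) // V ∈ 𝓤 X} := fun n => Nat.rec (F ⟨U, hU⟩) (fun _ V => F V) n
  refine ⟨fun n => (W n).1, ?_, fun n => (W n).2, fun n => ?_, fun n => hF2 _⟩
  · refine Subset.trans (fun p hp => ?_) (hF2 ⟨U, hU⟩)
    exact ⟨p.2, hp, refl_mem_uniformity (W 0).2⟩
  · cases n <;> exact hF1 _

theorem exists_uniformContinuous_separating {X : Type u} [𝒰 : UniformSpace X] {U : Set (X × X)}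
    (hU : U ∈ 𝓤 X) (x : X) :
    ∃ f : X → ℝ, UniformContinuous f ∧ f x = 0 ∧ ∃ ε > 0, ∀ y, f y < ε → (x, y) ∈ U := by
  obtain ⟨W, hWU, hW, hWs, hWc⟩ := exists_normal_sequence hU
  have hmono : ∀ n, W (n + 1) ⊆ W n := fun n p hp =>
    hWc n ⟨p.2, hp, refl_mem_uniformity (hW (n + 1))⟩
  have hanti : Antitone W := antitone_nat_of_succ_le hmono
  let B : FilterBasis (X × X) :=
    { sets := range W
      nonempty := range_nonempty W
      inter_sets := by
        rintro _ _ ⟨m, rfl⟩ ⟨n, rfl⟩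
        exact ⟨W (max m n), ⟨_, rfl⟩,
          subset_inter (hanti (le_max_left _ _)) (hanti (le_max_right _ _))⟩ }
  let c : UniformSpace.Core X := UniformSpace.Core.mkOfBasis B
    (by rintro _ ⟨n, rfl⟩ y; exact refl_mem_uniformity (hW n))
    (by
      rintro _ ⟨n, rfl⟩
      exact ⟨W n, ⟨n, rfl⟩, fun p hp => (hWs n).symm _ _ hp⟩)
    (by rintro _ ⟨n, rfl⟩; exact ⟨W (n + 1), ⟨_, rfl⟩, hWc n⟩)
  let v : UniformSpace X := UniformSpace.ofCore c
  have hle : 𝒰 ≤ v := by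
    intro s hs
    obtain ⟨_, ⟨n, rfl⟩, hn⟩ := B.mem_filter_iff.1 hs
    exact mem_of_superset (show W n ∈ 𝓤[𝒰] from hW n) hn
  have hb : (𝓤[v]).HasBasis (fun _ : ℕ => True) W := by
    refine ⟨fun s => ?_⟩
    constructor
    · intro hs
      obtain ⟨_, ⟨n, rfl⟩, hn⟩ := B.mem_filter_iff.1 hs
      exact ⟨n, trivial, hn⟩
    · rintro ⟨n, -, hn⟩
      exact B.mem_filter_iff.2 ⟨_, ⟨n, rfl⟩, hn⟩
  have hcg : (𝓤[v]).IsCountablyGenerated := hb.isCountablyGenerated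
  let pm : PseudoMetricSpace X := @UniformSpace.pseudoMetricSpace X v hcg
  have hpm : pm.toUniformSpace = v := rfl
  have hW0 : U ∈ 𝓤[v] := mem_of_superset (hb.mem_of_mem (i := 0) trivial) hWU
  rw [← hpm] at hW0
  obtain ⟨ε, hε, hεU⟩ := (@Metric.mem_uniformity_dist X pm U).1 hW0
  refine ⟨fun y => dist x y, ?_, dist_self x, ε, hε, fun y hy => hεU hy⟩
  have h1 : @UniformContinuous X ℝ v _ (fun y => dist x y) :=
    (uniformContinuous_const.dist uniformContinuous_id)
  exact Tendsto.mono_left h1 (show 𝓤[𝒰] ≤ 𝓤[v] from hle)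

theorem toTopologicalSpace_precompactReplica {X : Type u} (𝒰 : UniformSpace X) :
    (precompactReplica 𝒰).toTopologicalSpace = 𝒰.toTopologicalSpace := by
  refine le_antisymm ?_ (UniformSpace.toTopologicalSpace_mono (le_precompactReplica 𝒰))
  refine le_of_nhds_le_nhds fun x => ?_
  intro s hs
  obtain ⟨U, hU, hUs⟩ := UniformSpace.mem_nhds_iff.1 hs
  obtain ⟨f, hf, hfx, ε, hε, hfU⟩ := exists_uniformContinuous_separating hU x
  let f' : X → Icc (0 : ℝ) 1 := fun y => projIcc 0 1 zero_le_one (f y)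
  have hf' : UniformContinuous f' := (LipschitzWith.projIcc zero_le_one).uniformContinuous.comp hf
  let v : UniformSpace X := UniformSpace.comap f' inferInstance
  have hv : precompactReplica 𝒰 ≤ v := sInf_le
    ⟨uniformContinuous_iff_le_comap.1 hf',
      totallyBounded_univ_comap _ _ isCompact_univ.totallyBounded⟩
  refine (UniformSpace.toTopologicalSpace_mono hv : _ ≤ v.toTopologicalSpace) |>
    fun h => nhds_mono h ?_
  have hc : @Continuous X _ v.toTopologicalSpace _ f' :=
    @UniformContinuous.continuous X _ v _ f' (@uniformContinuous_comap X _ f' _)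
  have h0 : (f' x : ℝ) < min ε 1 := by
    simp [f', hfx, projIcc, hε]
  have := (@Continuous.tendsto X _ v.toTopologicalSpace _ f' hc x)
    ((isOpen_Iio.preimage continuous_subtype_val).mem_nhds (show f' x ∈ Subtype.val ⁻¹' Iio (min ε 1) from h0))
  refine mem_of_superset this fun y hy => hUs (hfU y ?_)
  have hy' : max 0 (min 1 (f y)) < min ε 1 := by simpa [f', projIcc] using hy
  by_contra hcon
  push Not at hcon
  have h2 : min ε 1 ≤ min 1 (f y) := by
    rw [min_comm]; exact min_le_min le_rfl hcon
  exact absurd (lt_of_le_of_lt (le_max_right 0 _) hy') (not_lt.2 h2)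

section Group

variable {G : Type u} [Group G]

/-- A totally bounded equiuniformity on the topological group `G`, for the action of `G` on itself
by multiplication on the left: a totally bounded uniformity which induces the topology of `G`, for
which all left translations are uniformly continuous (the action is saturated) and for which
sufficiently small uniform covers stay small when they are moved by elements of a sufficiently
small neighbourhood of the unit (the action is bounded). -/
structure IsTotallyBoundedEquiuniformity [t : TopologicalSpace G] (v : UniformSpace G) : Prop where
  compatible : v.toTopologicalSpace = t
  totallyBounded : @TotallyBounded G v univ
  saturated : ∀ g : G, @UniformContinuous G G v v (fun x => g * x)
  bounded : ∀ U ∈ 𝓤[v], ∃ O ∈ 𝓝 (1 : G), ∃ V ∈ 𝓤[v],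
    ∀ g ∈ O, ∀ h ∈ O, ∀ p ∈ V, (g * p.1, h * p.2) ∈ U

theorem IsTotallyBoundedEquiuniformity.exists_mul_mem [TopologicalSpace G] {v : UniformSpace G}
    (hv : IsTotallyBoundedEquiuniformity v) {U : Set (G × G)} (hU : U ∈ 𝓤[v]) :
    ∃ O ∈ 𝓝 (1 : G), ∀ g ∈ O, ∀ x, (x, g * x) ∈ U := by
  obtain ⟨O, hO, V, hV, h⟩ := hv.bounded U hU
  refine ⟨O, hO, fun g hg x => ?_⟩
  simpa using h 1 (mem_of_mem_nhds hO) g hg (x, x) (@refl_mem_uniformity G v x V hV)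

theorem isTotallyBoundedEquiuniformity_sInf [TopologicalSpace G] (S : Set (UniformSpace G))
    (hS : S.Nonempty) (h : ∀ v ∈ S, IsTotallyBoundedEquiuniformity v) :
    IsTotallyBoundedEquiuniformity (sInf S) where
  compatible := by
    rw [UniformSpace.toTopologicalSpace_sInf]
    obtain ⟨w, hw⟩ := hS
    refine le_antisymm ((iInf₂_le w hw).trans (h w hw).compatible.le) ?_
    exact le_iInf₂ fun v hv => (h v hv).compatible.ge
  totallyBounded := totallyBounded_univ_sInf S hS fun v hv => (h v hv).totallyBounded
  saturated g := by
    rw [uniformContinuous_sInf_rng]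
    exact fun v hv => uniformContinuous_sInf_dom hv ((h v hv).saturated g)
  bounded := by
    have key : Tendsto (fun q : (G × G) × (G × G) => (q.1.1 * q.2.1, q.1.2 * q.2.2))
        ((𝓝 1 ×ˢ 𝓝 1) ×ˢ 𝓤[sInf S]) 𝓤[sInf S] := by
      have hinf : 𝓤[sInf S] = ⨅ v : S, 𝓤[v.1] := by
        rw [sInf_eq_iInf', iInf_uniformity]
      conv => rhs; rw [hinf]
      refine tendsto_iInf.2 fun v => ?_
      have h1 : Tendsto (fun q : (G × G) × (G × G) => (q.1.1 * q.2.1, q.1.2 * q.2.2))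
          ((𝓝 1 ×ˢ 𝓝 1) ×ˢ 𝓤[v.1]) 𝓤[v.1] := by
        intro U hU
        obtain ⟨O, hO, V, hV, hOV⟩ := (h v.1 v.2).bounded U hU
        refine mem_map.2 (mem_of_superset (prod_mem_prod (prod_mem_prod hO hO) hV) ?_)
        rintro ⟨⟨g, k⟩, p⟩ ⟨⟨hg, hk⟩, hp⟩
        exact hOV g hg k hk p hp
      refine h1.mono_left (prod_mono le_rfl ?_)
      rw [hinf]
      exact iInf_le _ v
    intro U hU
    obtain ⟨s, hs, V, hV, hsV⟩ := mem_prod_iff.1 (key hU)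
    obtain ⟨O₁, hO₁, O₂, hO₂, hO⟩ := mem_prod_iff.1 hs
    refine ⟨O₁ ∩ O₂, inter_mem hO₁ hO₂, V, hV, fun g hg k hk p hp => ?_⟩
    exact hsV (show ((g, k), p) ∈ s ×ˢ V from ⟨hO ⟨hg.1, hk.2⟩, hp⟩)

/-- The Roelcke uniformity `L ∧ R`: the greatest lower bound of the left and the right uniformity,
i.e. the finest uniformity coarser than both (a supremum in Mathlib's order). -/
@[reducible] def roelckeUniformity (G : Type u) [Group G] [TopologicalSpace G]
    [IsTopologicalGroup G] : UniformSpace G :=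
  IsTopologicalGroup.leftUniformSpace G ⊔ IsTopologicalGroup.rightUniformSpace G

theorem exists_uniformity_mul_mul (G : Type u) [Group G] [t : TopologicalSpace G]
    [IsTopologicalGroup G] :
    ∃ ρ : UniformSpace G, roelckeUniformity G ≤ ρ ∧ ρ.toTopologicalSpace = t := by
  let F : Filter (G × G) :=
    ((𝓝 (1 : G) ×ˢ 𝓝 (1 : G)).lift' fun s : Set (G × G) =>
      {p : G × G | ∃ a ∈ s, p.2 = a.1 * p.1 * a.2})
  have hmono : Monotone fun s : Set (G × G) => {p : G × G | ∃ a ∈ s, p.2 = a.1 * p.1 * a.2} :=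
    fun s s' h p ⟨a, ha, hp⟩ => ⟨a, h ha, hp⟩
  have hF : ∀ {U : Set (G × G)}, U ∈ F ↔
      ∃ O ∈ 𝓝 (1 : G), ∀ a ∈ O, ∀ b ∈ O, ∀ x, (x, a * x * b) ∈ U := by
    intro U
    rw [mem_lift'_sets hmono]
    constructor
    · rintro ⟨s, hs, hsU⟩
      obtain ⟨O₁, hO₁, O₂, hO₂, hO⟩ := mem_prod_iff.1 hs
      exact ⟨O₁ ∩ O₂, inter_mem hO₁ hO₂, fun a ha b hb x => hsU ⟨(a, b), hO ⟨ha.1, hb.2⟩, rfl⟩⟩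
    · rintro ⟨O, hO, h⟩
      refine ⟨O ×ˢ O, prod_mem_prod hO hO, ?_⟩
      rintro ⟨x, y⟩ ⟨⟨a, b⟩, ⟨ha, hb⟩, hy⟩
      have hy' : y = a * x * b := hy
      rw [hy']
      exact h a ha b hb x
  let ρ : UniformSpace G :=
    { toTopologicalSpace := t
      uniformity := F
      symm := by
        intro U hU
        obtain ⟨O, hO, h⟩ := hF.1 hU
        refine hF.2 ⟨O⁻¹, inv_mem_nhds_one G hO, fun a ha b hb x => ?_⟩
        have := h a⁻¹ ha b⁻¹ hb (a * x * b)
        simpa [mul_assoc] using this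
      comp := by
        intro U hU
        obtain ⟨O, hO, h⟩ := hF.1 hU
        obtain ⟨V, hV, hVO⟩ := exists_nhds_one_split hO
        refine (mem_lift'_sets ?_).2 ⟨{p | ∃ a ∈ V, ∃ b ∈ V, p.2 = a * p.1 * b}, ?_, ?_⟩
        · exact fun s s' hs => SetRel.comp_subset_comp hs hs
        · exact hF.2 ⟨V, hV, fun a ha b hb x => ⟨a, ha, b, hb, rfl⟩⟩
        · rintro ⟨x, z⟩ ⟨y, ⟨a, ha, b, hb, hy⟩, ⟨c, hc, d, hd, hz⟩⟩
          simp only at hy hz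
          have := h (c * a) (hVO c hc a ha) (b * d) (hVO b hb d hd) x
          rw [hz, hy]
          simpa [mul_assoc] using this
      nhds_eq_comap_uniformity := by
        intro x
        ext s
        rw [mem_comap]
        constructor
        · intro hs
          have hc : Tendsto (fun p : G × G => p.1 * x * p.2) (𝓝 1 ×ˢ 𝓝 1) (𝓝 x) := by
            have : ContinuousAt (fun p : G × G => p.1 * x * p.2) (1, 1) := by fun_prop
            simpa [ContinuousAt, nhds_prod_eq] using this
          obtain ⟨O₁, hO₁, O₂, hO₂, hO⟩ := mem_prod_iff.1 (hc hs)
          refine ⟨{p | p.1 = x → p.2 ∈ s}, hF.2 ⟨O₁ ∩ O₂, inter_mem hO₁ hO₂, ?_⟩,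
            fun y hy => hy rfl⟩
          rintro a ha b hb y rfl
          exact hO (show (a, b) ∈ O₁ ×ˢ O₂ from ⟨ha.1, hb.2⟩)
        · rintro ⟨U, hU, hUs⟩
          obtain ⟨O, hO, h⟩ := hF.1 hU
          have hc : Tendsto (fun y : G => y * x⁻¹) (𝓝 x) (𝓝 1) := by
            have : ContinuousAt (fun y : G => y * x⁻¹) x := by fun_prop
            simpa [ContinuousAt] using this
          refine mem_of_superset (hc hO) fun y hy => hUs ?_
          simpa using h _ hy 1 (mem_of_mem_nhds hO) x }
  refine ⟨ρ, sup_le ?_ ?_, rfl⟩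
  · intro U hU
    obtain ⟨O, hO, h⟩ := hF.1 hU
    refine ⟨O, hO, ?_⟩
    rintro ⟨x, y⟩ hxy
    simpa using h 1 (mem_of_mem_nhds hO) (x⁻¹ * y) hxy x
  · intro U hU
    obtain ⟨O, hO, h⟩ := hF.1 hU
    refine ⟨O, hO, ?_⟩
    rintro ⟨x, y⟩ hxy
    simpa using h (y * x⁻¹) hxy 1 (mem_of_mem_nhds hO) x

theorem toTopologicalSpace_roelckeUniformity (G : Type u) [Group G] [t : TopologicalSpace G]
    [IsTopologicalGroup G] : (roelckeUniformity G).toTopologicalSpace = t := by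
  obtain ⟨ρ, hρ, hρt⟩ := exists_uniformity_mul_mul G
  refine le_antisymm ((UniformSpace.toTopologicalSpace_mono hρ).trans hρt.le) ?_
  exact UniformSpace.toTopologicalSpace_mono
    (le_sup_left : IsTopologicalGroup.leftUniformSpace G ≤ _)

theorem uniformContinuous_mul_left_roelcke (G : Type u) [Group G] [TopologicalSpace G]
    [IsTopologicalGroup G] (g : G) :
    @UniformContinuous G G (roelckeUniformity G) (roelckeUniformity G) (fun x => g * x) := by
  rw [uniformContinuous_iff_le_comap]
  refine sup_le (le_trans ?_ (UniformSpace.comap_mono le_sup_left))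
    (le_trans ?_ (UniformSpace.comap_mono le_sup_right))
  · rw [← uniformContinuous_iff_le_comap]
    refine tendsto_comap_iff.2 ?_
    have : ((fun p : G × G => p.1⁻¹ * p.2) ∘ fun x : G × G => (g * x.1, g * x.2)) =
        fun p : G × G => p.1⁻¹ * p.2 := by
      ext p; simp [mul_assoc]
    rw [this]
    exact tendsto_comap
  · rw [← uniformContinuous_iff_le_comap]
    refine tendsto_comap_iff.2 ?_
    have : ((fun p : G × G => p.2 * p.1⁻¹) ∘ fun x : G × G => (g * x.1, g * x.2)) =
        (fun y : G => g * y * g⁻¹) ∘ fun p : G × G => p.2 * p.1⁻¹ := by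
      ext p; simp [mul_assoc]
    rw [this]
    refine Tendsto.comp ?_ tendsto_comap
    have : ContinuousAt (fun y : G => g * y * g⁻¹) 1 := by fun_prop
    simpa [ContinuousAt] using this

theorem isTotallyBoundedEquiuniformity_roelcke (G : Type u) [Group G] [TopologicalSpace G]
    [IsTopologicalGroup G] :
    IsTotallyBoundedEquiuniformity (precompactReplica (roelckeUniformity G)) where
  compatible := (toTopologicalSpace_precompactReplica _).trans
    (toTopologicalSpace_roelckeUniformity G)
  totallyBounded := totallyBounded_precompactReplica _
  saturated g := uniformContinuous_precompactReplica _ _ (uniformContinuous_mul_left_roelcke G g)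
  bounded := by
    intro U hU
    let v := precompactReplica (roelckeUniformity G)
    have hR : IsTopologicalGroup.rightUniformSpace G ≤ v :=
      le_sup_right.trans (le_precompactReplica _)
    obtain ⟨W, hW, hWs, hWU⟩ := @comp_symm_mem_uniformity_sets G v U hU
    obtain ⟨V, hV, hVs, hVW⟩ := @comp_symm_mem_uniformity_sets G v W hW
    obtain ⟨O, hO, hOV⟩ := mem_comap.1 (show V ∈
      Filter.comap (fun p : G × G => p.2 * p.1⁻¹) (𝓝 1) from hR hV)
    refine ⟨O, hO, V, hV, fun g hg h hh p hp => hWU ?_⟩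
    have h1 : ∀ g ∈ O, ∀ x, (x, g * x) ∈ V := fun g hg x => hOV (by simpa using hg)
    exact ⟨p.2, hVW ⟨p.1, hVs.symm _ _ (h1 g hg p.1), hp⟩,
      hVW ⟨p.2, @refl_mem_uniformity G v p.2 V hV, h1 h hh p.2⟩⟩

/-- The maximal (that is, finest) totally bounded equiuniformity on `G`. -/
@[reducible] def maxTotallyBoundedEquiuniformity (G : Type u) [Group G] [TopologicalSpace G] :
    UniformSpace G :=
  sInf {v : UniformSpace G | IsTotallyBoundedEquiuniformity v}

theorem isTotallyBoundedEquiuniformity_max (G : Type u) [Group G] [TopologicalSpace G]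
    [IsTopologicalGroup G] :
    IsTotallyBoundedEquiuniformity (maxTotallyBoundedEquiuniformity G) :=
  isTotallyBoundedEquiuniformity_sInf _ ⟨_, isTotallyBoundedEquiuniformity_roelcke G⟩ fun _ h => h

end Group

/-- A proper `G`-compactification of the topological group `G`: a compact Hausdorff space with a
continuous left action of `G` and a dense topological embedding of `G` which is equivariant for
the left multiplication. (A compactification of `G` has at most `2 ^ 2 ^ |G|` points, so every one
is equivalent to one whose underlying space lives in the universe of `G`.) -/
structure GCompactification (G : Type u) [Group G] [TopologicalSpace G] : Type (u + 1) where
  carrier : Type u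
  [topologicalSpace : TopologicalSpace carrier]
  [compactSpace : CompactSpace carrier]
  [t2Space : T2Space carrier]
  [mulAction : MulAction G carrier]
  [continuousSMul : ContinuousSMul G carrier]
  emb : G → carrier
  isEmbedding_emb : IsEmbedding emb
  denseRange_emb : DenseRange emb
  emb_mul : ∀ g h : G, emb (g * h) = g • emb h

namespace GCompactification

attribute [instance] topologicalSpace compactSpace t2Space mulAction continuousSMul

variable {G : Type u} [Group G] [TopologicalSpace G]

/-- `b ≤ c` if there is a map of compactifications from `c` to `b`. -/
instance : LE (GCompactification G) where
  le b c := ∃ f : c.carrier → b.carrier, Continuous f ∧ ∀ g, f (c.emb g) = b.emb g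

/-- Two compactifications of `G` are identified when there is a homeomorphism between them which
is the identity on `G`. -/
def Equivalent (b c : GCompactification G) : Prop :=
  ∃ f : b.carrier ≃ₜ c.carrier, ∀ g, f (b.emb g) = c.emb g

end GCompactification

/-- Equality in the poset of compactifications. -/
infix:50 " ≅ᴳ " => GCompactification.Equivalent

namespace GCompactification

variable {G : Type u} [Group G] [TopologicalSpace G]

/-- `b` is a `G^*`-compactification: the involution of `G` extends to a continuous self-inverse
map of `b`. -/
def IsStar (b : GCompactification G) : Prop :=
  ∃ s : b.carrier → b.carrier, Continuous s ∧ (∀ x, s (s x) = x) ∧ ∀ g : G, s (b.emb g) = b.emb g⁻¹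

/-- `b` is an Ellis compactification: it carries a multiplication making it a right topological
monoid, such that multiplication by an element of `G` on the left is the extended action. -/
def IsEllis (b : GCompactification G) : Prop :=
  ∃ _ : Monoid b.carrier, (∀ y : b.carrier, Continuous fun x : b.carrier => x * y) ∧
    ∀ (g : G) (x : b.carrier), b.emb g * x = g • x

/-- The `G`-compactification obtained from an embedding of `G` in a compact `G`-space `Y`:
the closure of the image of `G`. -/
def ofClosure {Y : Type u} [TopologicalSpace Y] [CompactSpace Y] [T2Space Y] [MulAction G Y]
    [ContinuousSMul G Y] (i : G → Y) (hi : IsEmbedding i) (hmul : ∀ g h : G, i (g * h) = g • i h) :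
    GCompactification G :=
  have hsmul : ∀ (g : G), ∀ y ∈ closure (range i), g • y ∈ closure (range i) := fun g =>
    MapsTo.closure (f := fun y : Y => g • y)
      (by rintro _ ⟨h, rfl⟩; exact ⟨g * h, hmul g h⟩) (continuous_const_smul g)
  letI : MulAction G (closure (range i)) :=
    { smul := fun g y => ⟨g • y.1, hsmul g y.1 y.2⟩
      one_smul := fun y => Subtype.ext (one_smul G y.1)
      mul_smul := fun g h y => Subtype.ext (mul_smul g h y.1) }
  { carrier := closure (range i)
    compactSpace := isCompact_iff_compactSpace.1 isClosed_closure.isCompact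
    continuousSMul :=
      ⟨(continuous_fst.smul (continuous_subtype_val.comp continuous_snd)).subtype_mk _⟩
    emb := fun g => ⟨i g, subset_closure ⟨g, rfl⟩⟩
    isEmbedding_emb := hi.codRestrict _ _
    denseRange_emb := by
      refine Subtype.dense_iff.2 ?_
      have h : Subtype.val '' range (fun g => (⟨i g, subset_closure ⟨g, rfl⟩⟩ : closure (range i)))
          = range i := by
        rw [← range_comp]; rfl
      rw [h]
    emb_mul := fun g h => Subtype.ext (hmul g h) }

theorem continuous_smul_map (b : GCompactification G) :
    Continuous fun g : G => (fun x : b.carrier => g • x) :=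
  continuous_pi fun _ => continuous_id.smul continuous_const

theorem emb_eq_smul (b : GCompactification G) (g : G) : b.emb g = g • b.emb 1 := by
  simpa using b.emb_mul g 1

theorem isEmbedding_smul_map (b : GCompactification G) :
    IsEmbedding fun g : G => (fun x : b.carrier => g • x) := by
  refine IsEmbedding.of_comp b.continuous_smul_map (continuous_apply (b.emb 1)) ?_
  have : (fun f : b.carrier → b.carrier => f (b.emb 1)) ∘ (fun g : G => fun x => g • x) = b.emb :=
    funext fun g => (b.emb_eq_smul g).symm
  rw [this]
  exact b.isEmbedding_emb

/-- The Ellis map: `𝔈 b` is the closure of the image of `G` in the product space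
`b.carrier ^ b.carrier` of all self-maps of `b`, where `g` is sent to the self-map `x ↦ g • x`,
and `G` acts pointwise on self-maps. -/
def ellisMap (b : GCompactification G) : GCompactification G :=
  ofClosure (Y := b.carrier → b.carrier) (fun g x => g • x) b.isEmbedding_smul_map
    (fun g h => funext fun x => mul_smul g h x)

/-- The continuous action `g • R = {(x, g • y) | (x, y) ∈ R}` of `G` on the hyperspace of the closed
(equivalently, compact) subsets of `X × X`, with the Vietoris topology. -/
@[reducible] def relAction (G : Type u) [Group G] (X : Type u) [TopologicalSpace X] [MulAction G X]
    [ContinuousConstSMul G X] : MulAction G (TopologicalSpace.Compacts (X × X)) where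
  smul g R := R.map (fun p => (p.1, g • p.2)) (by fun_prop)
  one_smul R := by
    ext p
    change p ∈ (fun p : X × X => (p.1, (1 : G) • p.2)) '' (R : Set (X × X)) ↔ _
    simp
  mul_smul g h R := by
    apply SetLike.coe_injective
    change (fun p : X × X => (p.1, (g * h) • p.2)) '' (R : Set (X × X)) =
      (fun p : X × X => (p.1, g • p.2)) '' ((fun p : X × X => (p.1, h • p.2)) '' (R : Set (X × X)))
    rw [image_image]
    simp only [mul_smul]

theorem continuousSMul_relAction (X : Type u) [TopologicalSpace X] [MulAction G X]
    [ContinuousSMul G X] :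
    @ContinuousSMul G (TopologicalSpace.Compacts (X × X)) (relAction G X).toSMul _ _ := by
  let _ := relAction G X
  refine ⟨?_⟩
  exact Continuous.compacts_map' (f := fun q : G × TopologicalSpace.Compacts (X × X) => q.2)
    (g := fun q p => (p.1, q.1 • p.2)) continuous_snd (by fun_prop)

/-- The graph `{(x, g • x)}` of an element of `G` acting on the compact space `X`. -/
def graph {X : Type u} [TopologicalSpace X] [CompactSpace X] [MulAction G X]
    [ContinuousSMul G X] (g : G) : TopologicalSpace.Compacts (X × X) where
  carrier := {p | p.2 = g • p.1}
  isCompact' := by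
    have : {p : X × X | p.2 = g • p.1} = range fun x : X => (x, g • x) := by
      ext ⟨x, y⟩; simp [eq_comm]
    rw [this]
    exact isCompact_range (by fun_prop)

theorem graph_eq_map {X : Type u} [TopologicalSpace X] [CompactSpace X] [MulAction G X]
    [ContinuousSMul G X] (g : G) : (graph g : TopologicalSpace.Compacts (X × X)) =
      (⊤ : TopologicalSpace.Compacts X).map (fun x => (x, g • x)) (by fun_prop) := by
  apply SetLike.coe_injective
  change {p : X × X | p.2 = g • p.1} = (fun x : X => (x, g • x)) '' univ
  ext ⟨x, y⟩; simp [eq_comm]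

theorem isEmbedding_graph (b : GCompactification G) :
    IsEmbedding (graph : G → TopologicalSpace.Compacts (b.carrier × b.carrier)) := by
  have hcont : Continuous (graph : G → TopologicalSpace.Compacts (b.carrier × b.carrier)) := by
    have : (graph : G → TopologicalSpace.Compacts (b.carrier × b.carrier)) = fun g =>
      (⊤ : TopologicalSpace.Compacts b.carrier).map (fun x => (x, g • x)) (by fun_prop) :=
      funext graph_eq_map
    rw [this]
    exact Continuous.compacts_map' (f := fun _ : G => (⊤ : TopologicalSpace.Compacts b.carrier))
      (g := fun g x => (x, g • x)) continuous_const (by fun_prop)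
  have hsub : ∀ (g : G) (W : Set b.carrier),
      ((graph g : TopologicalSpace.Compacts (b.carrier × b.carrier)) : Set (b.carrier × b.carrier))
        ⊆ ({b.emb 1}ᶜ ×ˢ univ) ∪ (univ ×ˢ W) ↔ b.emb g ∈ W := by
    intro g W
    rw [b.emb_eq_smul g]
    constructor
    · intro h
      rcases h (show (b.emb 1, g • b.emb 1) ∈ {p : b.carrier × b.carrier | p.2 = g • p.1} from rfl)
        with h | h
      · exact (h.1 rfl).elim
      · exact h.2
    · rintro h ⟨x, y⟩ hxy
      have hxy' : y = g • x := hxy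
      by_cases hx : x = b.emb 1
      · right; exact ⟨trivial, by rw [hxy', hx]; exact h⟩
      · left; exact ⟨hx, trivial⟩
  refine ⟨⟨le_antisymm hcont.le_induced ?_⟩, ?_⟩
  · refine le_trans ?_ b.isEmbedding_emb.eq_induced.ge
    rintro _ ⟨W, hW, rfl⟩
    refine ⟨{R | (R : Set (b.carrier × b.carrier)) ⊆ ({b.emb 1}ᶜ ×ˢ univ) ∪ (univ ×ˢ W)},
      TopologicalSpace.Compacts.isOpen_subsets_of_isOpen
        ((isOpen_compl_singleton.prod isOpen_univ).union (isOpen_univ.prod hW)), ?_⟩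
    ext g
    exact hsub g W
  · intro g h hgh
    apply b.isEmbedding_emb.injective
    have := (hsub h {b.emb h}).2 rfl
    rw [← hgh] at this
    exact (hsub g {b.emb h}).1 this

/-- The map given by the method of graphs: `𝔊 b` is the closure of the set of graphs of the
elements of `G` in the hyperspace of closed relations on `b` with the Vietoris topology. -/
def graphMap (b : GCompactification G) : GCompactification G :=
  letI := relAction G b.carrier
  haveI : ContinuousSMul G (TopologicalSpace.Compacts (b.carrier × b.carrier)) :=
    continuousSMul_relAction b.carrier
  ofClosure (Y := TopologicalSpace.Compacts (b.carrier × b.carrier)) graph b.isEmbedding_graph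
    (fun g h => by
      apply SetLike.coe_injective
      change {p : b.carrier × b.carrier | p.2 = (g * h) • p.1} =
        (fun p : b.carrier × b.carrier => (p.1, g • p.2)) '' {p | p.2 = h • p.1}
      ext ⟨x, y⟩
      simp [mul_smul, eq_comm])

theorem isEllis_ellisMap (b : GCompactification G) : b.ellisMap.IsEllis := by
  let E : Set (b.carrier → b.carrier) := closure (range fun (g : G) x => g • x)
  have hcomp : ∀ f ∈ E, ∀ k ∈ E, f ∘ k ∈ E := by
    intro f hf k hk
    have h1 : ∀ g : G, (fun x => g • k x) ∈ E := by
      intro g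
      have hc : Continuous fun k : b.carrier → b.carrier => fun x => g • k x := by fun_prop
      refine MapsTo.closure ?_ hc hk
      rintro _ ⟨h, rfl⟩
      exact ⟨g * h, funext fun x => mul_smul g h x⟩
    have hc : Continuous fun f : b.carrier → b.carrier => f ∘ k :=
      continuous_pi fun x => continuous_apply (k x)
    have : MapsTo (fun f : b.carrier → b.carrier => f ∘ k) (closure (range fun (g : G) x => g • x))
        (closure E) := by
      refine MapsTo.closure ?_ hc
      rintro _ ⟨g, rfl⟩
      exact h1 g
    have := this hf
    rwa [closure_closure] at this
  let M : Monoid E :=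
    { mul := fun f k => ⟨f.1 ∘ k.1, hcomp f.1 f.2 k.1 k.2⟩
      mul_assoc := fun _ _ _ => rfl
      one := ⟨id, subset_closure ⟨1, funext fun x => one_smul G x⟩⟩
      one_mul := fun _ => rfl
      mul_one := fun _ => rfl }
  refine ⟨M, fun k => ?_, fun g k => rfl⟩
  exact Continuous.subtype_mk
    (continuous_pi fun x => (continuous_apply (k.1 x)).comp
      (continuous_subtype_val : Continuous (Subtype.val : E → b.carrier → b.carrier))) _

theorem isStar_graphMap (b : GCompactification G) : b.graphMap.IsStar := by
  let σ : TopologicalSpace.Compacts (b.carrier × b.carrier) →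
      TopologicalSpace.Compacts (b.carrier × b.carrier) :=
    TopologicalSpace.Compacts.map Prod.swap continuous_swap
  have hσ : Continuous σ := Continuous.compacts_map continuous_swap
  have hg : ∀ g : G, σ (graph g) = graph g⁻¹ := by
    intro g
    apply SetLike.coe_injective
    change Prod.swap '' {p : b.carrier × b.carrier | p.2 = g • p.1} = {p | p.2 = g⁻¹ • p.1}
    ext ⟨x, y⟩
    simp [image_swap_eq_preimage_swap, eq_inv_smul_iff, eq_comm]
  have hσσ : ∀ R, σ (σ R) = R := by
    intro R
    apply SetLike.coe_injective
    change Prod.swap '' (Prod.swap '' (R : Set (b.carrier × b.carrier))) = R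
    rw [image_image]
    simp
  have hmem : MapsTo σ (closure (range (graph : G → _))) (closure (range (graph : G → _))) := by
    refine MapsTo.closure ?_ hσ
    rintro _ ⟨g, rfl⟩
    exact ⟨g⁻¹, (hg g).symm⟩
  refine ⟨fun R => ⟨σ R.1, hmem R.2⟩, ?_, fun R => Subtype.ext (hσσ R.1), fun g =>
    Subtype.ext (hg g)⟩
  exact Continuous.subtype_mk (hσ.comp continuous_subtype_val) _

end GCompactification

section Completion

theorem continuousSMul_completion {G : Type u} [Group G] [v : UniformSpace G]
    [IsTopologicalGroup G] [UniformContinuousConstSMul G G]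
    (hv : IsTotallyBoundedEquiuniformity v) :
    ContinuousSMul G (UniformSpace.Completion G) := by
  refine ⟨continuous_iff_continuousAt.2 ?_⟩
  rintro ⟨g₀, x₀⟩
  refine (Uniform.tendsto_nhds_right).2 fun U hU => mem_map.2 ?_
  obtain ⟨W, hW, hWs, hWU⟩ := comp_symm_mem_uniformity_sets hU
  obtain ⟨D, ⟨hD, hDc⟩, hDW⟩ := uniformity_hasBasis_closed.mem_iff.1 hW
  have hD' : {p : G × G | ((p.1 : UniformSpace.Completion G), (p.2 : UniformSpace.Completion G)) ∈ D}
      ∈ 𝓤[v] := UniformSpace.Completion.uniformContinuous_coe G hD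
  obtain ⟨O, hO, h⟩ := hv.exists_mul_mem hD'
  have key : ∀ g : G, g * g₀⁻¹ ∈ O → ∀ x : UniformSpace.Completion G, (g₀ • x, g • x) ∈ D := by
    intro g hg x
    induction x using UniformSpace.Completion.induction_on with
    | hp => exact hDc.preimage ((continuous_const_smul g₀).prodMk (continuous_const_smul g))
    | ih a =>
      have := h _ hg (g₀ * a)
      simp only [mem_ofPred_eq, mul_assoc, inv_mul_cancel_left] at this
      rw [← UniformSpace.Completion.coe_smul, ← UniformSpace.Completion.coe_smul]
      exact this
  have h1 : ∀ᶠ g in 𝓝 g₀, g * g₀⁻¹ ∈ O := by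
    have hc : ContinuousAt (fun g : G => g * g₀⁻¹) g₀ := by fun_prop
    have hc' : Tendsto (fun g : G => g * g₀⁻¹) (𝓝 g₀) (𝓝 1) := by
      simpa [ContinuousAt] using hc
    exact hc' hO
  have h2 : ∀ᶠ x in 𝓝 x₀, (g₀ • x₀, g₀ • x) ∈ W :=
    Uniform.tendsto_nhds_right.1
      (continuous_const_smul g₀ : Continuous fun x : UniformSpace.Completion G => g₀ • x).continuousAt
      hW
  rw [nhds_prod_eq]
  filter_upwards [h1.prod_mk h2] with p hp
  exact hWU ⟨g₀ • p.2, hp.2, hDW (key p.1 hp.1 p.2)⟩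

theorem compactSpace_completion {X : Type u} [UniformSpace X]
    (h : TotallyBounded (univ : Set X)) : CompactSpace (UniformSpace.Completion X) := by
  refine ⟨isCompact_iff_totallyBounded_isComplete.2 ⟨?_, isComplete_univ⟩⟩
  have h1 := (h.image (UniformSpace.Completion.uniformContinuous_coe X)).closure
  rw [image_univ] at h1
  rwa [UniformSpace.Completion.denseRange_coe.closure_range] at h1

end Completion

namespace GCompactification

variable {G : Type u} [Group G] [TopologicalSpace G]

/-- The `G`-compactification given by a totally bounded equiuniformity `v`: the completion of
`(G, v)`, with the action extended from the left multiplication. -/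
noncomputable def ofUniformity [IsTopologicalGroup G] [T2Space G] (v : UniformSpace G)
    (hv : IsTotallyBoundedEquiuniformity v) : GCompactification G :=
  letI w : UniformSpace G := v.replaceTopology hv.compatible.symm
  have hw : w = v := UniformSpace.replaceTopology_eq v _
  haveI : UniformContinuousConstSMul G G := ⟨fun g => by
    change @UniformContinuous G G w w (fun x => g * x)
    rw [hw]
    exact hv.saturated g⟩
  { carrier := UniformSpace.Completion G
    compactSpace := compactSpace_completion (by rw [hw]; exact hv.totallyBounded)
    mulAction := inferInstance
    continuousSMul := continuousSMul_completion (v := w) (by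
      rw [← hw] at hv
      exact hv)
    emb := fun g => (g : UniformSpace.Completion G)
    isEmbedding_emb := (UniformSpace.Completion.isUniformEmbedding_coe G).isEmbedding
    denseRange_emb := UniformSpace.Completion.denseRange_coe
    emb_mul := fun g h => UniformSpace.Completion.coe_smul g h }

/-- The Roelcke compactification `b_r G`: the Samuel compactification of `(G, L ∧ R)`, i.e. the
completion of `G` with respect to the precompact replica of the Roelcke uniformity. -/
noncomputable def roelcke (G : Type u) [Group G] [TopologicalSpace G] [IsTopologicalGroup G]
    [T2Space G] : GCompactification G :=
  ofUniformity (precompactReplica (roelckeUniformity G)) (isTotallyBoundedEquiuniformity_roelcke G)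

/-- The maximal `G`-compactification `β_G G`: the completion of `G` with respect to the maximal
totally bounded equiuniformity. -/
noncomputable def maximal (G : Type u) [Group G] [TopologicalSpace G] [IsTopologicalGroup G]
    [T2Space G] : GCompactification G :=
  ofUniformity (maxTotallyBoundedEquiuniformity G) (isTotallyBoundedEquiuniformity_max G)

end GCompactification

/-- A SIN-group: the conjugation invariant neighbourhoods of the unit form a base at the unit
(equivalently, the left and the right uniformity coincide). -/
def IsSINGroup (G : Type u) [Group G] [TopologicalSpace G] : Prop :=
  ∀ U ∈ 𝓝 (1 : G), ∃ V ∈ 𝓝 (1 : G), V ⊆ U ∧ ∀ g : G, ∀ x ∈ V, g * x * g⁻¹ ∈ V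

/-! A compact Hausdorff space has a single compatible uniformity. A $G$-compactification is
therefore determined by the trace of that uniformity on $G$, and $b\le c$ means that the trace of
$c$ refines that of $b$ (`le_iff_unif_le`). Every equality in the theorem is proved as two opposite
inequalities.

Continuity of the action makes every trace coarser than $R$. If $b$ is a $G^*$-compactification,
inversion is uniformly continuous for the trace and exchanges $L$ and $R$. The trace is then also
coarser than $L$, hence than $L\wedge R$, and $b\le b_rG$ (`IsStar.le_roelcke`). This applies to
every $\mathfrak G(b)$.

The converse estimate is $b\le\mathfrak G(b)$ for $G^*$-compactifications (`IsStar.le_graphMap`). A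
trace coarser than $L$ makes $gx$ close to $g$, uniformly in $g$, for all $x$ near the unit. Graphs
that are close near the unit thus belong to close elements. Since $b_rG$ is itself a
$G^*$-compactification and $\mathfrak G$ is monotone, $b_rG\le b$ gives $b_rG\le\mathfrak
G(b_rG)\le\mathfrak G(b)\le b_rG$.

On the Ellis side, $b\le\mathfrak E(b)$ always holds, $\mathfrak E$ is monotone, and $\mathfrak
E(b)\le b$ when $b$ is Ellis. The rest is maximality of $\beta_GG$ and, for SIN-groups, $L=R$. -/

namespace GCompactification

/-! ### Compactifications as uniformities on $G$. -/

section Uniformity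

variable {G : Type u} [Group G] [TopologicalSpace G]

/-- The trace on `G` of the unique uniformity of the compact Hausdorff space `b`. -/
@[reducible] def unif (b : GCompactification G) : UniformSpace G :=
  (uniformSpaceOfCompactR1 : UniformSpace b.carrier).comap b.emb

theorem uniformContinuous_comp_emb (b : GCompactification G) {Y : Type*} [UniformSpace Y]
    {f : b.carrier → Y} (hf : Continuous f) : UniformContinuous[b.unif, _] (f ∘ b.emb) := by
  let _ : UniformSpace b.carrier := uniformSpaceOfCompactR1
  let _ : UniformSpace G := b.unif
  exact (CompactSpace.uniformContinuous_of_continuous hf).comp uniformContinuous_comap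

/-- The target is compact, hence complete, so a uniformly continuous map extends from the dense copy
of $G$. -/
theorem exists_continuous_extension (b c : GCompactification G) {f : G → G}
    (hf : UniformContinuous[b.unif, c.unif] f) :
    ∃ F : b.carrier → c.carrier, Continuous F ∧ ∀ g, F (b.emb g) = c.emb (f g) := by
  let _ : UniformSpace b.carrier := uniformSpaceOfCompactR1
  let _ : UniformSpace c.carrier := uniformSpaceOfCompactR1
  have hf' : UniformContinuous[b.unif, _] (c.emb ∘ f) :=
    @UniformContinuous.comp G G c.carrier b.unif c.unif _ _ _
      (@uniformContinuous_comap _ _ c.emb _) hf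
  let _ : UniformSpace G := b.unif
  have he : IsUniformInducing b.emb := ⟨rfl⟩
  exact ⟨_, (uniformContinuous_uniformly_extend he b.denseRange_emb hf').continuous,
    uniformly_extend_of_ind he b.denseRange_emb hf'⟩

theorem le_iff_unif_le {b c : GCompactification G} : b ≤ c ↔ c.unif ≤ b.unif := by
  constructor
  · rintro ⟨f, hf, hfe⟩
    let _ : UniformSpace b.carrier := uniformSpaceOfCompactR1
    have h := c.uniformContinuous_comp_emb hf
    rw [show f ∘ c.emb = b.emb from funext hfe] at h
    exact uniformContinuous_iff_le_comap.1 h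
  · intro h
    refine exists_continuous_extension c b (f := id) ?_
    rw [uniformContinuous_iff_le_comap]
    simpa using h

instance : Preorder (GCompactification G) where
  le_refl _ := le_iff_unif_le.2 le_rfl
  le_trans _ _ _ h h' := le_iff_unif_le.2 ((le_iff_unif_le.1 h').trans (le_iff_unif_le.1 h))

theorem equivalent_of_le_of_le {b c : GCompactification G} (h : b ≤ c) (h' : c ≤ b) : b ≅ᴳ c := by
  obtain ⟨f, hf, hfe⟩ := h'
  obtain ⟨k, hk, hke⟩ := h
  refine ⟨⟨⟨f, k, fun x => ?_, fun x => ?_⟩, hf, hk⟩, hfe⟩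
  · exact congrFun (b.denseRange_emb.equalizer (hk.comp hf) continuous_id
      (funext fun g => by simp [hfe, hke])) x
  · exact congrFun (c.denseRange_emb.equalizer (hf.comp hk) continuous_id
      (funext fun g => by simp [hfe, hke])) x

/-- The image is compact, hence closed, and it contains the dense copy of $G$. -/
theorem surjective_of_extends {b c : GCompactification G} {f : c.carrier → b.carrier}
    (hf : Continuous f) (hfe : ∀ g, f (c.emb g) = b.emb g) : Function.Surjective f := by
  have hd : DenseRange f := b.denseRange_emb.mono (by
    rintro _ ⟨g, rfl⟩
    exact ⟨c.emb g, hfe g⟩)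
  exact range_eq_univ.1 ((isCompact_range hf).isClosed.closure_eq.symm.trans hd.closure_range)

theorem smul_of_extends {b c : GCompactification G} {f : c.carrier → b.carrier}
    (hf : Continuous f) (hfe : ∀ g, f (c.emb g) = b.emb g) (g : G) (x : c.carrier) :
    f (g • x) = g • f x :=
  congrFun (c.denseRange_emb.equalizer (hf.comp (continuous_const_smul g))
    (hf.const_smul g) (funext fun h => by simp [← emb_mul, hfe])) x

theorem isTotallyBoundedEquiuniformity_unif [IsTopologicalGroup G] (b : GCompactification G) :
    IsTotallyBoundedEquiuniformity b.unif := by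
  let _ : UniformSpace b.carrier := uniformSpaceOfCompactR1
  refine ⟨b.isEmbedding_emb.eq_induced.symm,
    totallyBounded_univ_comap _ _ isCompact_univ.totallyBounded, fun g => ?_, fun U hU => ?_⟩
  · rw [uniformContinuous_iff_le_comap, ← UniformSpace.comap_comap,
      ← uniformContinuous_iff_le_comap]
    have := b.uniformContinuous_comp_emb (continuous_const_smul g)
    rwa [show (fun x : b.carrier => g • x) ∘ b.emb = b.emb ∘ fun x => g * x from
      funext fun h => (b.emb_mul g h).symm] at this
  · obtain ⟨D, hD, hDU⟩ := mem_comap.1 hU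
    obtain ⟨W, hW, hWs, hWD⟩ := comp_symm_mem_uniformity_sets hD
    obtain ⟨V, hV, hVs, hVW⟩ := comp_symm_mem_uniformity_sets hW
    -- Currying the action gives a continuous map into the compact-open topology, which is uniform
    -- convergence here because $bG$ is compact. Elements near the unit therefore move all points of
    -- $bG$ uniformly little.
    let F : C(G, C(b.carrier, b.carrier)) :=
      ContinuousMap.curry ⟨fun p : G × b.carrier => p.1 • p.2, continuous_smul⟩
    have hO : ∀ᶠ g : G in 𝓝 1, ∀ x : b.carrier, (x, g • x) ∈ V := by
      have h := (ContinuousMap.tendsto_iff_tendstoUniformly.1 (F.continuous.tendsto 1)) V hV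
      simpa [F] using h
    refine ⟨_, hO, Prod.map b.emb b.emb ⁻¹' V, preimage_mem_comap hV, ?_⟩
    intro g hg h hh p hp
    refine hDU (hWD ?_)
    change (b.emb (g * p.1), b.emb (h * p.2)) ∈ _
    rw [emb_mul, emb_mul]
    exact ⟨b.emb p.2, hVW ⟨b.emb p.1, hVs.symm _ _ (hg (b.emb p.1)), hp⟩,
      hVW ⟨b.emb p.2, refl_mem_uniformity hV, hh (b.emb p.2)⟩⟩

/-- Write $y=(yx^{-1})x$: when $yx^{-1}$ is near the unit, it moves $x$ by little, uniformly in $x$.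
-/
theorem rightUniformSpace_le_unif [IsTopologicalGroup G] (b : GCompactification G) :
    IsTopologicalGroup.rightUniformSpace G ≤ b.unif := by
  intro U hU
  obtain ⟨O, hO, h⟩ := b.isTotallyBoundedEquiuniformity_unif.exists_mul_mem hU
  refine mem_comap.2 ⟨O, hO, ?_⟩
  rintro ⟨x, y⟩ hxy
  simpa using h (y * x⁻¹) hxy x

theorem isStar_iff_uniformContinuous_inv {b : GCompactification G} :
    b.IsStar ↔ UniformContinuous[b.unif, b.unif] (fun g : G => g⁻¹) := by
  constructor
  · rintro ⟨s, hs, -, hse⟩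
    let _ : UniformSpace b.carrier := uniformSpaceOfCompactR1
    rw [uniformContinuous_iff_le_comap, ← UniformSpace.comap_comap,
      ← uniformContinuous_iff_le_comap]
    have := b.uniformContinuous_comp_emb hs
    rwa [show s ∘ b.emb = b.emb ∘ fun x => x⁻¹ from funext hse] at this
  · intro h
    obtain ⟨s, hs, hse⟩ := exists_continuous_extension b b h
    exact ⟨s, hs, fun x => congrFun (b.denseRange_emb.equalizer (hs.comp hs) continuous_id
      (funext fun g => by simp [hse])) x, hse⟩

theorem IsStar.leftUniformSpace_le_unif [IsTopologicalGroup G] {b : GCompactification G}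
    (hb : b.IsStar) : IsTopologicalGroup.leftUniformSpace G ≤ b.unif := by
  intro U hU
  have h := isStar_iff_uniformContinuous_inv.1 hb hU
  obtain ⟨O, hO, hOU⟩ := mem_comap.1 (b.rightUniformSpace_le_unif h)
  -- The right quotient of $(x^{-1},y^{-1})$ is $y^{-1}x=(x^{-1}y)^{-1}$, hence $O^{-1}$.
  refine mem_comap.2 ⟨O⁻¹, inv_mem_nhds_one G hO, ?_⟩
  rintro ⟨x, y⟩ hxy
  have : (x⁻¹, y⁻¹) ∈ (fun p : G × G => p.2 * p.1⁻¹) ⁻¹' O := by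
    simpa using hxy
  simpa using hOU this

/-- The completion is compact, so its own uniformity is the unique compatible one, and that induces
`v` on $G$. -/
theorem unif_ofUniformity [IsTopologicalGroup G] [T2Space G] (v : UniformSpace G)
    (hv : IsTotallyBoundedEquiuniformity v) : (ofUniformity v hv).unif = v := by
  let w : UniformSpace G := v.replaceTopology hv.compatible.symm
  have hw : w = v := UniformSpace.replaceTopology_eq v _
  have : CompactSpace (UniformSpace.Completion G) :=
    compactSpace_completion (by rw [hw]; exact hv.totallyBounded)
  have h : (inferInstance : UniformSpace (UniformSpace.Completion G)) =
      uniformSpaceOfCompactR1 := unique_uniformity_of_compact rfl rfl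
  change (uniformSpaceOfCompactR1 : UniformSpace (UniformSpace.Completion G)).comap
    (fun g : G => (g : UniformSpace.Completion G)) = v
  rw [← h, ← hw]
  exact (UniformSpace.Completion.isUniformInducing_coe G).comap_uniformSpace

end Uniformity

end GCompactification

namespace GCompactification

/-! ### The method of graphs: monotonicity and $G^*$-compactifications. -/

section Graphs

variable {G : Type u} [Group G] [TopologicalSpace G]

/-- The map $R\mapsto(f\times f)(R)$ is continuous on hyperspaces. It sends the graph of $g$ onto
the graph of $g$ because $f$ is equivariant and surjective. -/
theorem graphMap_mono {b c : GCompactification G} (h : b ≤ c) : b.graphMap ≤ c.graphMap := by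
  obtain ⟨f, hf, hfe⟩ := h
  let φ : TopologicalSpace.Compacts (c.carrier × c.carrier) →
      TopologicalSpace.Compacts (b.carrier × b.carrier) :=
    TopologicalSpace.Compacts.map (Prod.map f f) (hf.prodMap hf)
  have hφ : Continuous φ := (hf.prodMap hf).compacts_map
  have hg : ∀ g : G, φ (graph g) = graph g := by
    intro g
    apply SetLike.coe_injective
    change Prod.map f f '' {p : c.carrier × c.carrier | p.2 = g • p.1} = {p | p.2 = g • p.1}
    ext ⟨x, y⟩
    constructor
    · rintro ⟨⟨a, a'⟩, (ha : a' = g • a), h⟩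
      obtain ⟨rfl, rfl⟩ := Prod.mk.inj h
      exact ha ▸ smul_of_extends hf hfe g a
    · intro (hy : y = g • x)
      obtain ⟨a, rfl⟩ := surjective_of_extends hf hfe x
      exact ⟨(a, g • a), rfl, Prod.ext rfl ((smul_of_extends hf hfe g a).trans hy.symm)⟩
  have hm : MapsTo φ (closure (range (graph : G → _))) (closure (range (graph : G → _))) := by
    refine MapsTo.closure ?_ hφ
    rintro _ ⟨g, rfl⟩
    exact ⟨g, (hg g).symm⟩
  exact ⟨fun R => ⟨φ R.1, hm R.2⟩, (hφ.comp continuous_subtype_val).subtype_mk _,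
    fun g => Subtype.ext (hg g)⟩

/-- For a `G^*`-compactification, `g` is determined, uniformly, by the graph of `g` near the
unit. -/
theorem IsStar.le_graphMap [IsTopologicalGroup G] {b : GCompactification G} (hb : b.IsStar) :
    b ≤ b.graphMap := by
  rw [le_iff_unif_le]
  let _ : UniformSpace b.carrier := uniformSpaceOfCompactR1
  intro U hU
  obtain ⟨D, hD, hDU⟩ := mem_comap.1 hU
  obtain ⟨W, hW, hWs, hWD⟩ := comp_symm_mem_uniformity_sets hD
  obtain ⟨C, ⟨hC, hCc⟩, hCW⟩ := uniformity_hasBasis_closed.mem_iff.1 hW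
  obtain ⟨O, hO, hOC⟩ := mem_comap.1 (hb.leftUniformSpace_le_unif
    (preimage_mem_comap (m := Prod.map b.emb b.emb) hC))
  rw [b.isEmbedding_emb.nhds_eq_comap] at hO
  obtain ⟨S, hS, hSO⟩ := mem_comap.1 hO
  obtain ⟨T, hTS, hT, h1T⟩ := mem_nhds_iff.1 hS
  -- For $x=o\in G$ this is closeness of $g$ and $go$ in $L$. Density of $G$ in the open set `T` and
  -- closedness of `C` carry it to all of `T`; the same `T` serves every $g$.
  have key : ∀ (g : G), ∀ x ∈ T, (b.emb g, g • x) ∈ C := by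
    intro g x hx
    have hcl := b.denseRange_emb.open_subset_closure_inter hT hx
    have hcl' : IsClosed {x : b.carrier | (b.emb g, g • x) ∈ C} :=
      hCc.preimage (continuous_const.prodMk (continuous_const_smul g))
    refine closure_minimal ?_ hcl' hcl
    rintro _ ⟨ho, ⟨o, rfl⟩⟩
    have : (g, g * o) ∈ (fun p : G × G => p.1⁻¹ * p.2) ⁻¹' O := by
      simpa using hSO (hTS ho)
    simpa [emb_mul] using hOC this
  obtain ⟨V, hV, hVT⟩ := UniformSpace.mem_nhds_iff.1 (hT.mem_nhds h1T)
  have huc := b.graphMap.uniformContinuous_comp_emb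
    (Y := TopologicalSpace.Compacts (b.carrier × b.carrier))
    (f := fun R : closure (range (graph : G → _)) => R.1) continuous_subtype_val
  have hN := huc ((𝓤 (b.carrier × b.carrier)).basis_sets.uniformity_compacts.mem_of_mem
    (entourageProd_mem_uniformity hV hW))
  refine mem_of_superset hN ?_
  rintro ⟨g, h⟩ hgh
  -- The point $(e,g)$ of the graph of $g$ has a nearby partner $(x,hx)$ on the graph of $h$. Here
  -- $x\in T$, so $g$ is close to $hx$ and, by `key`, $hx$ is close to $h$.
  obtain ⟨⟨x, y⟩, hy, hx, hgy⟩ := hgh.1 (show (b.emb 1, b.emb g) ∈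
    {p : b.carrier × b.carrier | p.2 = g • p.1} from b.emb_eq_smul g)
  have hy' : y = h • x := hy
  subst hy'
  exact hDU (hWD ⟨h • x, hgy, hWs.symm _ _ (hCW (key h x (hVT hx)))⟩)

end Graphs

/-! ### The Ellis map: monotonicity and Ellis compactifications. -/

section Ellis

variable {G : Type u} [Group G] [TopologicalSpace G]

/-- The comparison map is evaluation at the unit. -/
theorem le_ellisMap (b : GCompactification G) : b ≤ b.ellisMap :=
  ⟨fun F : closure (range fun (g : G) (x : b.carrier) => g • x) => F.1 (b.emb 1),
    (continuous_apply _).comp continuous_subtype_val, fun g => (b.emb_eq_smul g).symm⟩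

theorem ellisMap_mono {b c : GCompactification G} (h : b ≤ c) : b.ellisMap ≤ c.ellisMap := by
  obtain ⟨f, hf, hfe⟩ := h
  -- An arbitrary section suffices: in the topology of pointwise convergence $F\mapsto f\circ
  -- F\circ\sigma$ is continuous even if $\sigma$ is not. By equivariance of $f$ it sends
  -- translations to translations.
  obtain ⟨σ, hσ⟩ := (surjective_of_extends hf hfe).hasRightInverse
  let φ : (c.carrier → c.carrier) → b.carrier → b.carrier := fun F y => f (F (σ y))
  have hφ : Continuous φ := continuous_pi fun y => hf.comp (continuous_apply (σ y))
  have hg : ∀ g : G, φ (fun x => g • x) = fun y => g • y := by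
    intro g
    funext y
    exact (smul_of_extends hf hfe g (σ y)).trans (by rw [hσ y])
  have hm : MapsTo φ (closure (range fun (g : G) (x : c.carrier) => g • x))
      (closure (range fun (g : G) (x : b.carrier) => g • x)) := by
    refine MapsTo.closure ?_ hφ
    rintro _ ⟨g, rfl⟩
    exact ⟨g, (hg g).symm⟩
  exact ⟨fun R => ⟨φ R.1, hm R.2⟩, (hφ.comp continuous_subtype_val).subtype_mk _,
    fun g => Subtype.ext (hg g)⟩

/-- Send $x$ to the self-map $y\mapsto x\bullet y$. Continuity into the product is exactly
continuity of each $x\mapsto x\bullet y$. -/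
theorem IsEllis.ellisMap_le {b : GCompactification G} (hb : b.IsEllis) : b.ellisMap ≤ b := by
  obtain ⟨_, hc, he⟩ := hb
  let φ : b.carrier → b.carrier → b.carrier := fun x y => x * y
  have hφ : Continuous φ := continuous_pi hc
  have hg : ∀ g : G, φ (b.emb g) = fun y => g • y := fun g => funext (he g)
  have hm : ∀ x, φ x ∈ closure (range fun (g : G) (x : b.carrier) => g • x) := by
    intro x
    refine MapsTo.closure ?_ hφ (b.denseRange_emb x)
    rintro _ ⟨g, rfl⟩
    exact ⟨g, (hg g).symm⟩
  exact ⟨fun x => ⟨φ x, hm x⟩, hφ.subtype_mk _, fun g => Subtype.ext (hg g)⟩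

end Ellis

/-! ### The Roelcke and the maximal compactification. -/

section Roelcke

variable {G : Type u} [Group G] [TopologicalSpace G] [IsTopologicalGroup G]

/-- Inversion exchanges $L$ and $R$, so it preserves their greatest lower bound. -/
theorem uniformContinuous_inv_roelcke :
    UniformContinuous[roelckeUniformity G, roelckeUniformity G] (fun g : G => g⁻¹) := by
  rw [uniformContinuous_iff_le_comap]
  refine sup_le (le_trans ?_ (UniformSpace.comap_mono le_sup_right))
    (le_trans ?_ (UniformSpace.comap_mono le_sup_left))
  all_goals
    rw [← uniformContinuous_iff_le_comap]
    refine tendsto_comap_iff.2 ?_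
  · have h : Tendsto (fun p : G × G => p.1⁻¹ * p.2)
        (Filter.comap (fun p : G × G => p.1⁻¹ * p.2) (𝓝 1)) (𝓝 1) := tendsto_comap
    convert h.inv using 1
    · ext p
      simp
    · rfl
    · rw [inv_one]
  · have h : Tendsto (fun p : G × G => p.2 * p.1⁻¹)
        (Filter.comap (fun p : G × G => p.2 * p.1⁻¹) (𝓝 1)) (𝓝 1) := tendsto_comap
    convert h.inv using 1
    · ext p
      simp
    · rfl
    · rw [inv_one]

variable [T2Space G]

/-- Traces are totally bounded, so being coarser than $L\wedge R$ is the same as being coarser than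
its precompact replica. -/
theorem le_roelcke_iff {b : GCompactification G} :
    b ≤ roelcke G ↔ roelckeUniformity G ≤ b.unif := by
  rw [le_iff_unif_le, roelcke, unif_ofUniformity]
  exact ⟨(le_precompactReplica _).trans,
    fun h => sInf_le ⟨h, b.isTotallyBoundedEquiuniformity_unif.totallyBounded⟩⟩

theorem le_maximal (b : GCompactification G) : b ≤ maximal G := by
  rw [le_iff_unif_le, maximal, unif_ofUniformity]
  exact sInf_le b.isTotallyBoundedEquiuniformity_unif

theorem IsStar.le_roelcke {b : GCompactification G} (hb : b.IsStar) : b ≤ roelcke G :=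
  le_roelcke_iff.2 (sup_le hb.leftUniformSpace_le_unif b.rightUniformSpace_le_unif)

theorem isStar_roelcke : (roelcke G).IsStar := by
  rw [isStar_iff_uniformContinuous_inv, roelcke, unif_ofUniformity]
  exact uniformContinuous_precompactReplica _ _ uniformContinuous_inv_roelcke

theorem graphMap_le_roelcke (b : GCompactification G) : b.graphMap ≤ roelcke G :=
  b.isStar_graphMap.le_roelcke

theorem roelcke_equivalent_graphMap {b : GCompactification G} (h : roelcke G ≤ b) :
    roelcke G ≅ᴳ b.graphMap :=
  equivalent_of_le_of_le (isStar_roelcke.le_graphMap.trans (graphMap_mono h))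
    b.graphMap_le_roelcke

theorem maximal_le_roelcke (hG : IsSINGroup G) : maximal G ≤ roelcke G := by
  refine le_roelcke_iff.2 (sup_le (le_trans ?_ (rightUniformSpace_le_unif _))
    (rightUniformSpace_le_unif _))
  intro U hU
  obtain ⟨O, hO, hOU⟩ := mem_comap.1 hU
  obtain ⟨V, hV, hVO, hVc⟩ := hG O hO
  refine mem_comap.2 ⟨V, hV, ?_⟩
  rintro ⟨x, y⟩ hxy
  refine hOU (hVO ?_)
  -- $yx^{-1}$ is the conjugate $x(x^{-1}y)x^{-1}$.
  simpa [mul_assoc] using hVc x _ hxy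

end Roelcke

end GCompactification

/-! ### Assembling the inequalities. -/

theorem mainTheorem7 (G : Type u) [Group G] [TopologicalSpace G] [IsTopologicalGroup G]
    [T2Space G] :
    -- (a)
    (∀ b : GCompactification G, GCompactification.roelcke G ≤ b →
      (GCompactification.roelcke G ≅ᴳ b.graphMap ∧ b.graphMap ≤ b ∧ b ≤ b.ellisMap) ∧
      (GCompactification.roelcke G ≅ᴳ b.graphMap ∧
        b.graphMap ≤ (GCompactification.roelcke G).ellisMap ∧
        (GCompactification.roelcke G).ellisMap ≤ b.ellisMap)) ∧
    -- (b)
    ((GCompactification.roelcke G ≅ᴳ (GCompactification.maximal G).graphMap ∧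
        (GCompactification.maximal G).graphMap ≤ GCompactification.maximal G ∧
        GCompactification.maximal G ≅ᴳ (GCompactification.maximal G).ellisMap) ∧
      (IsSINGroup G →
        GCompactification.roelcke G ≅ᴳ (GCompactification.maximal G).graphMap ∧
        (GCompactification.maximal G).graphMap ≅ᴳ GCompactification.maximal G ∧
        GCompactification.maximal G ≅ᴳ (GCompactification.maximal G).ellisMap)) ∧
    -- (c)
    ((GCompactification.roelcke G).IsEllis →
      (GCompactification.roelcke G).graphMap ≅ᴳ (GCompactification.roelcke G).ellisMap ∧
      (GCompactification.roelcke G).ellisMap ≅ᴳ GCompactification.roelcke G) ∧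
    -- (d)
    (∀ b : GCompactification G, b.IsStar → b.IsEllis →
      b ≅ᴳ b.ellisMap ∧ b.ellisMap ≤ b.graphMap ∧ b.graphMap ≤ GCompactification.roelcke G) := by
  have hmax := GCompactification.le_maximal (GCompactification.roelcke G)
  have hE : GCompactification.maximal G ≅ᴳ (GCompactification.maximal G).ellisMap :=
    GCompactification.equivalent_of_le_of_le (GCompactification.le_ellisMap _)
      (GCompactification.le_maximal _)
  have hG := GCompactification.roelcke_equivalent_graphMap hmax
  have hle := (GCompactification.graphMap_le_roelcke (GCompactification.maximal G)).trans hmax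
  refine ⟨fun b hb => ?_, ⟨⟨hG, hle, hE⟩, fun hS => ⟨hG, ?_, hE⟩⟩, fun h => ?_, fun b hs he => ?_⟩
  · have h := GCompactification.roelcke_equivalent_graphMap hb
    have h' := b.graphMap_le_roelcke
    exact ⟨⟨h, h'.trans hb, b.le_ellisMap⟩, h,
      h'.trans (GCompactification.le_ellisMap _), GCompactification.ellisMap_mono hb⟩
  -- For SIN-groups: $\beta_GG\le b_rG\le\mathfrak G(b_rG)\le\mathfrak G(\beta_GG)$.
  · exact GCompactification.equivalent_of_le_of_le hle
      ((GCompactification.maximal_le_roelcke hS).trans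
        (GCompactification.isStar_roelcke.le_graphMap.trans
          (GCompactification.graphMap_mono hmax)))
  -- Both equalities come from the cycle $\mathfrak G(b_rG)\le b_rG\le\mathfrak E(b_rG)\le
  -- b_rG\le\mathfrak G(b_rG)$; only $\mathfrak E(b_rG)\le b_rG$ uses the Ellis structure.
  · exact ⟨GCompactification.equivalent_of_le_of_le
        ((GCompactification.graphMap_le_roelcke _).trans (GCompactification.le_ellisMap _))
        (h.ellisMap_le.trans GCompactification.isStar_roelcke.le_graphMap),
      GCompactification.equivalent_of_le_of_le h.ellisMap_le (GCompactification.le_ellisMap _)⟩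
  · exact ⟨GCompactification.equivalent_of_le_of_le b.le_ellisMap he.ellisMap_le,
      he.ellisMap_le.trans hs.le_graphMap, b.graphMap_le_roelcke⟩
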